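/- Let $SO(3)$ be the group of rotations of $\mathbb{R}^3$, and let $P\subset SO(3)$ be the set of rotations having a rotation axis in the $x$-$z$ plane (this includes the identity). Identifying $\mathbb{R}^3$ with the pure quaternions, with $I,J,K$ the standard basis vectors along the $x$-, $y$-, $z$-axes, $P$ is the set of conjugations by the nonzero quaternions $w_0+w_1I+w_2K$. With the homogeneous coordinates $[w_0:w_1:w_2]$, it is a closed smooth $2$-manifold diffeomorphic to $\mathbb{RP}^2$. For $0\le s\le \pi/2$ and $0\le t\le 2\pi$ let $D(s,t)\in P$ be conjugation by the unit quaternion $$\widehat D(s,t)=\bigl(1-2\cos^2 s\,\sin^2(t/2)\bigr)+I\,\sin(2s)\sin^2(t/2)+K\,\cos s\,\sin t .$$ Let $Q$ be the quotient space of the rectangle $[0,\pi/2]\times[0,2\pi]$ obtained by collapsing the three edges $t=0$, $t=2\pi$, $s=\pi/2$ to one point and identifying $(0,t)$ with $(0,t+\pi)$ for $0\le t\le\pi$. The map $D$ induces a homeomorphism $\overline D\colon Q\to P$, and $Q$ is given the differentiable structure that makes $\overline D$ a diffeomorphism. For $v\in S^2$ let $e_v\colon SO(3)\to S^2$, $e_v(A)=Av$.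 Then for every $v\in S^2$, both maps $e_v|_P\colon P\to S^2$ and $e_v\circ\overline D\colon Q\to S^2$ are smooth maps between closed $2$-manifolds and have nonzero mod two degree. Here a smooth map $f\colon M\to N$ of closed $n$-manifolds, $N$ connected, has mod two degree $d\in\mathbb{Z}/2$ if regular values of $f$ exist and for every regular value $y$ the set $f^{-1}(y)$ is finite with cardinality congruent to $d$ modulo two. Moreover, for each of the two maps there is an open dense subset of $S^2$ all of whose points are regular values with exactly one preimage. -/

import Mathlib

open Set Topology
open scoped Manifold ContDiff Matrix Quaternion

noncomputable section

namespace DoubleTwist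

/-! ### Rotations of three-space and the evaluation maps -/

/-- The rotation group `SO(3)`, with the topology inherited from the `3 × 3` matrices. -/
abbrev SO3 : Type := Matrix.specialOrthogonalGroup (Fin 3) ℝ

/-- The unit sphere `S²` in Euclidean three-space. -/
abbrev S2 : Type := Metric.sphere (0 : EuclideanSpace ℝ (Fin 3)) 1

instance : ConnectedSpace S2 := by
  refine Subtype.connectedSpace (isConnected_sphere ?_ _ zero_le_one)
  rw [← Module.finrank_eq_rank, finrank_euclideanSpace]
  simp

theorem orthogonal_mul_transpose (A : SO3) : A.1 * A.1ᵀ = 1 := by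
  have := (Matrix.mem_specialOrthogonalGroup_iff.1 A.2).1
  exact (Matrix.mem_orthogonalGroup_iff (Fin 3) ℝ).1 this

theorem transpose_mul_orthogonal (A : SO3) : A.1ᵀ * A.1 = 1 :=
  mul_eq_one_comm.1 (orthogonal_mul_transpose A)

theorem mulVec_mem_sphere (A : SO3) (v : S2) :
    WithLp.toLp 2 (A.1 *ᵥ v.1.ofLp) ∈ Metric.sphere (0 : EuclideanSpace ℝ (Fin 3)) 1 := by
  have hv : ‖v.1‖ = 1 := mem_sphere_zero_iff_norm.1 v.2
  have h1 : ∀ x : EuclideanSpace ℝ (Fin 3), ‖x‖ ^ 2 = x.ofLp ⬝ᵥ x.ofLp := by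
    intro x
    rw [EuclideanSpace.norm_sq_eq]
    simp [dotProduct, sq]
  have h2 : ‖(WithLp.toLp 2 (A.1 *ᵥ v.1.ofLp) : EuclideanSpace ℝ (Fin 3))‖ ^ 2 = 1 := by
    rw [h1, Matrix.dotProduct_mulVec, Matrix.vecMul_mulVec, transpose_mul_orthogonal,
      Matrix.vecMul_one, ← h1, hv, one_pow]
  rw [mem_sphere_zero_iff_norm]
  exact (pow_eq_one_iff_of_nonneg (norm_nonneg _) two_ne_zero).1 h2

/-- The evaluation map `e_v : SO(3) → S²`, `A ↦ A v`. -/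
def evalAt (v : S2) (A : SO3) : S2 := ⟨WithLp.toLp 2 (A.1 *ᵥ v.1.ofLp), mulVec_mem_sphere A v⟩

/-- The set `P` of rotations having a rotation axis in the `x`-`z` plane (the coordinates
`x, y, z` are numbered `0, 1, 2`). -/
def P : Set SO3 := {A | ∃ u : Fin 3 → ℝ, u ≠ 0 ∧ u 1 = 0 ∧ A.1 *ᵥ u = u}

/-! ### Quaternions and rotations -/

/-- The pure quaternion `x I + y J + z K`. -/
def pureQuat (v : Fin 3 → ℝ) : ℍ[ℝ] := ⟨0, v 0, v 1, v 2⟩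

/-- The coordinates of the imaginary part of a quaternion. -/
def imPart (q : ℍ[ℝ]) : Fin 3 → ℝ := ![q.imI, q.imJ, q.imK]

/-- The matrix of the conjugation action `v ↦ q v q⁻¹` on pure quaternions, with respect to
the basis `I, J, K`. -/
def conjMatrix (q : ℍ[ℝ]) : Matrix (Fin 3) (Fin 3) ℝ :=
  Matrix.of fun i j => imPart (q * pureQuat (Pi.single j 1) * q⁻¹) i

theorem conjMatrix_eq (q : ℍ[ℝ]) : conjMatrix q =
    (q.re ^ 2 + q.imI ^ 2 + q.imJ ^ 2 + q.imK ^ 2)⁻¹ •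
    !![q.re ^ 2 + q.imI ^ 2 - q.imJ ^ 2 - q.imK ^ 2, 2 * (q.imI * q.imJ - q.re * q.imK),
        2 * (q.imI * q.imK + q.re * q.imJ);
      2 * (q.imI * q.imJ + q.re * q.imK), q.re ^ 2 - q.imI ^ 2 + q.imJ ^ 2 - q.imK ^ 2,
        2 * (q.imJ * q.imK - q.re * q.imI);
      2 * (q.imI * q.imK - q.re * q.imJ), 2 * (q.imJ * q.imK + q.re * q.imI),
        q.re ^ 2 - q.imI ^ 2 - q.imJ ^ 2 + q.imK ^ 2] := by
  have h : q⁻¹ = (q.re ^ 2 + q.imI ^ 2 + q.imJ ^ 2 + q.imK ^ 2)⁻¹ • star q := by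
    rw [← Quaternion.normSq_def']; rfl
  ext i j
  have h0 : ∀ v, (pureQuat v).re = 0 := fun _ => rfl
  have h1 : ∀ v, (pureQuat v).imI = v 0 := fun _ => rfl
  have h2 : ∀ v, (pureQuat v).imJ = v 1 := fun _ => rfl
  have h3 : ∀ v, (pureQuat v).imK = v 2 := fun _ => rfl
  rw [conjMatrix, Matrix.of_apply, h]
  fin_cases i <;> fin_cases j <;>
    simp [imPart, h0, h1, h2, h3, Quaternion.re_mul, Quaternion.imI_mul, Quaternion.imJ_mul,
      Quaternion.imK_mul] <;> exact Or.inl (by ring)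

theorem normSq_ne {q : ℍ[ℝ]} (hq : q ≠ 0) :
    q.re ^ 2 + q.imI ^ 2 + q.imJ ^ 2 + q.imK ^ 2 ≠ 0 := by
  rw [← Quaternion.normSq_def']
  simpa using hq

theorem conjMatrix_mem {q : ℍ[ℝ]} (hq : q ≠ 0) :
    conjMatrix q ∈ Matrix.specialOrthogonalGroup (Fin 3) ℝ := by
  have h := normSq_ne hq
  rw [Matrix.mem_specialOrthogonalGroup_iff, Matrix.mem_orthogonalGroup_iff, conjMatrix_eq]
  constructor
  · ext i j
    fin_cases i <;> fin_cases j <;>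
      simp [Matrix.mul_apply, Fin.sum_univ_three] <;> field_simp <;> ring
  · rw [Matrix.det_smul, Matrix.det_fin_three]
    simp
    field_simp
    ring

/-- The rotation "conjugation by `q`", for a nonzero quaternion `q`. -/
def rot (q : ℍ[ℝ]) (hq : q ≠ 0) : SO3 := ⟨conjMatrix q, conjMatrix_mem hq⟩

/-- The quaternion `w₀ + w₁ I + w₂ K`, with vanishing `J` component. -/
def planeQuat (w : Fin 3 → ℝ) : ℍ[ℝ] := ⟨w 0, w 1, 0, w 2⟩

theorem planeQuat_ne {w : Fin 3 → ℝ} (hw : w ≠ 0) : planeQuat w ≠ 0 := by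
  intro h
  apply hw
  rw [Quaternion.ext_iff] at h
  ext i
  fin_cases i
  · exact h.1
  · exact h.2.1
  · exact h.2.2.2

theorem sum_sq_ne {w : Fin 3 → ℝ} (hw : w ≠ 0) : w 0 ^ 2 + w 1 ^ 2 + w 2 ^ 2 ≠ 0 := by
  simpa [planeQuat] using normSq_ne (planeQuat_ne hw)

theorem conjMatrix_planeQuat (w : Fin 3 → ℝ) : conjMatrix (planeQuat w) =
    (w 0 ^ 2 + w 1 ^ 2 + w 2 ^ 2)⁻¹ •
    !![w 0 ^ 2 + w 1 ^ 2 - w 2 ^ 2, -(2 * (w 0 * w 2)), 2 * (w 1 * w 2);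
      2 * (w 0 * w 2), w 0 ^ 2 - w 1 ^ 2 - w 2 ^ 2, -(2 * (w 0 * w 1));
      2 * (w 1 * w 2), 2 * (w 0 * w 1), w 0 ^ 2 - w 1 ^ 2 + w 2 ^ 2] := by
  rw [conjMatrix_eq]
  simp [planeQuat]

theorem rot_mem_P {w : Fin 3 → ℝ} (hw : w ≠ 0) : rot (planeQuat w) (planeQuat_ne hw) ∈ P := by
  have hn := sum_sq_ne hw
  by_cases h : w 1 = 0 ∧ w 2 = 0
  · refine ⟨![1, 0, 0], fun h0 => by simpa using congrFun h0 0, rfl, ?_⟩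
    have h0 : w 0 ≠ 0 := by simpa [h.1, h.2] using hn
    simp only [rot, conjMatrix_planeQuat, h.1, h.2]
    ext i
    fin_cases i <;> simp [Matrix.mulVec, dotProduct, Fin.sum_univ_three, h0]
  · refine ⟨![w 1, 0, w 2], fun h0 => h ⟨by simpa using congrFun h0 0,
      by simpa using congrFun h0 2⟩, rfl, ?_⟩
    simp only [rot, conjMatrix_planeQuat]
    ext i
    fin_cases i <;> simp [Matrix.mulVec, dotProduct, Fin.sum_univ_three] <;> field_simp <;> ring

/-- The element of `P` given by conjugation by the nonzero quaternion `w₀ + w₁ I + w₂ K`. -/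
def rotP (w : Fin 3 → ℝ) (hw : w ≠ 0) : P := ⟨rot (planeQuat w) (planeQuat_ne hw), rot_mem_P hw⟩

theorem exists_rotP (A : P) : ∃ (w : Fin 3 → ℝ) (hw : w ≠ 0), A = rotP w hw := by
  obtain ⟨A, u, hu0, hu1, hu⟩ := A
  obtain ⟨a, b, hab, hb⟩ : ∃ a b : ℝ, a ^ 2 + b ^ 2 = 1 ∧ A.1 *ᵥ ![a, 0, b] = ![a, 0, b] := by
    have hpos : 0 < u 0 ^ 2 + u 2 ^ 2 := by
      by_contra! h
      apply hu0
      ext i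
      fin_cases i
      · simp; nlinarith
      · exact hu1
      · simp; nlinarith
    set c := √(u 0 ^ 2 + u 2 ^ 2) with hc
    have hc0 : 0 < c := Real.sqrt_pos.2 hpos
    have hc2 : c ^ 2 = u 0 ^ 2 + u 2 ^ 2 := Real.sq_sqrt hpos.le
    refine ⟨u 0 / c, u 2 / c, by field_simp; linarith, ?_⟩
    have : (![u 0 / c, 0, u 2 / c] : Fin 3 → ℝ) = c⁻¹ • u := by
      ext i
      fin_cases i <;> simp [hu1] <;> field_simp
    rw [this, Matrix.mulVec_smul, hu]
  have hbT : A.1ᵀ *ᵥ ![a, 0, b] = ![a, 0, b] := by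
    conv_lhs => rw [← hb]
    rw [Matrix.mulVec_mulVec, transpose_mul_orthogonal, Matrix.one_mulVec]
  have hdet := (Matrix.mem_specialOrthogonalGroup_iff.1 A.2).2
  have hadj : A.1.adjugate = A.1ᵀ := by
    have h := Matrix.mul_adjugate A.1
    rw [hdet, one_smul] at h
    calc A.1.adjugate = A.1ᵀ * (A.1 * A.1.adjugate) := by
          rw [← mul_assoc, transpose_mul_orthogonal, one_mul]
      _ = A.1ᵀ := by rw [h, mul_one]
  have hcol : A.1 0 1 ^ 2 + A.1 1 1 ^ 2 + A.1 2 1 ^ 2 = 1 := by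
    have := congrFun (congrFun (transpose_mul_orthogonal A) 1) 1
    simp [Matrix.mul_apply, Fin.sum_univ_three] at this
    linarith
  have c0 := congrFun (congrFun hadj 0) 1
  have c1 := congrFun (congrFun hadj 2) 1
  have c2 := congrFun (congrFun hadj 1) 1
  have e0 := congrFun hb 0
  have e1 := congrFun hb 1
  have e2 := congrFun hb 2
  have f0 := congrFun hbT 0
  have f1 := congrFun hbT 1
  have f2 := congrFun hbT 2
  simp [Matrix.adjugate_fin_three] at c0 c1 c2
  simp [Matrix.mulVec, dotProduct, Fin.sum_univ_three] at e0 e1 e2 f0 f1 f2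
  obtain ⟨β, hβ⟩ : ∃ β, β = -b * A.1 0 1 + a * A.1 2 1 := ⟨_, rfl⟩
  have a01 : A.1 0 1 = -(b * β) := by grind
  have a21 : A.1 2 1 = a * β := by grind
  have a10 : A.1 1 0 = b * β := by grind
  have a12 : A.1 1 2 = -(a * β) := by grind
  have a02 : A.1 0 2 = A.1 2 0 := by grind
  have a00 : A.1 0 0 = a ^ 2 + A.1 1 1 * b ^ 2 := by grind
  have a22 : A.1 2 2 = b ^ 2 + A.1 1 1 * a ^ 2 := by grind
  have a20 : A.1 2 0 = a * b * (1 - A.1 1 1) := by grind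
  have hαβ : A.1 1 1 ^ 2 + β ^ 2 = 1 := by grind
  obtain ⟨z, hz⟩ := IsAlgClosed.exists_pow_nat_eq (⟨A.1 1 1, β⟩ : ℂ) two_pos
  have hz1 : z.re ^ 2 - z.im ^ 2 = A.1 1 1 := by
    have := congrArg Complex.re hz
    simp [sq] at this
    linarith
  have hz2 : 2 * (z.re * z.im) = β := by
    have := congrArg Complex.im hz
    simp [sq] at this
    linarith
  have hz3 : z.re ^ 2 + z.im ^ 2 = 1 := by
    have : (z.re ^ 2 + z.im ^ 2) ^ 2 = 1 := by rw [← hαβ, ← hz1, ← hz2]; ring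
    exact (pow_eq_one_iff_of_nonneg (by positivity) two_ne_zero).1 this
  have hN : z.re ^ 2 + (z.im * a) ^ 2 + (z.im * b) ^ 2 = 1 := by
    linear_combination hz3 + z.im ^ 2 * hab
  refine ⟨![z.re, z.im * a, z.im * b], fun h => ?_, ?_⟩
  · have h0 := congrFun h 0
    have h1 := congrFun h 1
    have h2 := congrFun h 2
    simp only [Matrix.cons_val, Pi.zero_apply] at h0 h1 h2
    rw [h0, h1, h2] at hN
    norm_num at hN
  · apply Subtype.ext
    apply Subtype.ext
    simp only [rotP, rot, conjMatrix_planeQuat, Matrix.cons_val, hN]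
    ext i j
    fin_cases i <;> fin_cases j <;> simp [a00, a01, a02, a10, a12, a20, a21, a22] <;> grind

/-! ### The smooth structure of `P` -/

/-- For `A` the conjugation by `w₀ + w₁ I + w₂ K` of norm one, this is the matrix of the
products `wᵢ wⱼ`; the ratios of its entries are the homogeneous coordinates `[w₀ : w₁ : w₂]`
of `A` under the identification of `P` with the real projective plane. -/
def quatGram (A : SO3) : Matrix (Fin 3) (Fin 3) ℝ :=
  !![(1 + A.1 0 0 + A.1 1 1 + A.1 2 2) / 4, A.1 2 1 / 2, A.1 1 0 / 2;
    A.1 2 1 / 2, (1 + A.1 0 0 - A.1 1 1 - A.1 2 2) / 4, A.1 0 2 / 2;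
    A.1 1 0 / 2, A.1 0 2 / 2, (1 - A.1 0 0 - A.1 1 1 + A.1 2 2) / 4]

theorem quatGram_rotP (w : Fin 3 → ℝ) (hw : w ≠ 0) (i j : Fin 3) :
    quatGram (rotP w hw).1 i j = w i * w j / (w 0 ^ 2 + w 1 ^ 2 + w 2 ^ 2) := by
  have hn := sum_sq_ne hw
  simp only [rotP, rot, conjMatrix_planeQuat, quatGram]
  fin_cases i <;> fin_cases j <;> simp <;> field_simp <;> ring

theorem continuous_entry (i j : Fin 3) : Continuous fun A : P => A.1.1 i j := by
  have h0 : Continuous fun A : SO3 => A.1 := continuous_subtype_val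
  have h1 : Continuous fun A : P => A.1.1 := h0.comp continuous_subtype_val
  exact h1.matrix_elem i j

theorem continuous_quatGram (i j : Fin 3) : Continuous fun A : P => quatGram A.1 i j := by
  have h := continuous_entry
  fin_cases i <;> fin_cases j
  · exact (((continuous_const.add (h 0 0)).add (h 1 1)).add (h 2 2)).div_const 4
  · exact (h 2 1).div_const 2
  · exact (h 1 0).div_const 2
  · exact (h 2 1).div_const 2
  · exact (((continuous_const.add (h 0 0)).sub (h 1 1)).sub (h 2 2)).div_const 4
  · exact (h 0 2).div_const 2
  · exact (h 1 0).div_const 2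
  · exact (h 0 2).div_const 2
  · exact (((continuous_const.sub (h 0 0)).sub (h 1 1)).add (h 2 2)).div_const 4

theorem continuous_rotP {X : Type*} [TopologicalSpace X] {w : X → Fin 3 → ℝ}
    (hw : Continuous w) (h0 : ∀ x, w x ≠ 0) : Continuous fun x => rotP (w x) (h0 x) := by
  refine Continuous.subtype_mk (Continuous.subtype_mk ?_ _) _
  simp only [conjMatrix_planeQuat]
  have hi : ∀ i, Continuous fun x => w x i := fun i => (continuous_apply i).comp hw
  refine Continuous.smul (Continuous.inv₀ (by fun_prop) fun x => sum_sq_ne (h0 x)) ?_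
  refine continuous_matrix fun i j => ?_
  fin_cases i <;> fin_cases j <;> simp <;> fun_prop

theorem rotP_smul (w : Fin 3 → ℝ) (hw : w ≠ 0) {c : ℝ} (hc : c ≠ 0) :
    rotP (c • w) (smul_ne_zero hc hw) = rotP w hw := by
  have hn := sum_sq_ne hw
  apply Subtype.ext
  apply Subtype.ext
  simp only [rotP, rot, conjMatrix_planeQuat]
  have : (c * w 0) ^ 2 + (c * w 1) ^ 2 + (c * w 2) ^ 2 = c ^ 2 * (w 0 ^ 2 + w 1 ^ 2 + w 2 ^ 2) := by
    ring
  ext i j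
  fin_cases i <;> fin_cases j <;> simp [this] <;> field_simp

/-- The point of `ℝ³` whose `i`-th coordinate is `1` and whose other coordinates are `a`. -/
def affinePt (i : Fin 3) (a : EuclideanSpace ℝ (Fin 2)) : Fin 3 → ℝ :=
  i.insertNth (α := fun _ => ℝ) 1 a.ofLp

theorem affinePt_self (i : Fin 3) (a : EuclideanSpace ℝ (Fin 2)) : affinePt i a i = 1 := by
  simp [affinePt]

theorem affinePt_ne (i : Fin 3) (a : EuclideanSpace ℝ (Fin 2)) : affinePt i a ≠ 0 :=
  fun h => one_ne_zero ((affinePt_self i a).symm.trans (congrFun h i))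

theorem contDiff_affinePt (i m : Fin 3) :
    ContDiff ℝ ∞ fun a : EuclideanSpace ℝ (Fin 2) => affinePt i a m := by
  rcases Fin.eq_self_or_eq_succAbove i m with rfl | ⟨k, rfl⟩
  · simp only [affinePt_self]
    exact contDiff_const
  · simp only [affinePt, Fin.insertNth_apply_succAbove]
    fun_prop

/-- The affine chart `[w₀ : w₁ : w₂] ↦ (w_j / w_i, w_k / w_i)`, `{i, j, k} = {0, 1, 2}`, `j < k`,
defined on the elements of `P` with `w_i ≠ 0`. -/
def affineChart (i : Fin 3) : OpenPartialHomeomorph P (EuclideanSpace ℝ (Fin 2)) where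
  toFun A := WithLp.toLp 2 fun k => quatGram A.1 i (i.succAbove k) / quatGram A.1 i i
  invFun a := rotP (affinePt i a) (affinePt_ne i a)
  source := {A | quatGram A.1 i i ≠ 0}
  target := univ
  map_source' _ _ := mem_univ _
  map_target' a _ := by
    have := sum_sq_ne (affinePt_ne i a)
    simpa [quatGram_rotP, affinePt_self] using this
  left_inv' A hA := by
    obtain ⟨w, hw, rfl⟩ := exists_rotP A
    have hn := sum_sq_ne hw
    have hi : w i ≠ 0 := by
      intro h
      apply hA
      rw [quatGram_rotP, h]
      simp
    rw [← rotP_smul w hw (inv_ne_zero hi)]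
    congr 1
    ext m
    rcases Fin.eq_self_or_eq_succAbove i m with rfl | ⟨k, rfl⟩
    · simp [affinePt_self, hi]
    · simp only [affinePt, Fin.insertNth_apply_succAbove, quatGram_rotP, Pi.smul_apply,
        smul_eq_mul]
      field_simp
  right_inv' a _ := by
    ext k
    have hn := sum_sq_ne (affinePt_ne i a)
    simp only [quatGram_rotP, affinePt_self]
    simp only [affinePt, Fin.insertNth_apply_succAbove] at hn ⊢
    field_simp
  open_source := isOpen_ne_fun (continuous_quatGram i i) continuous_const
  open_target := isOpen_univ
  continuousOn_toFun := by
    refine (PiLp.continuous_toLp 2 _).comp_continuousOn (continuousOn_pi.2 fun k => ?_)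
    exact (continuous_quatGram _ _).continuousOn.div (continuous_quatGram _ _).continuousOn
      fun A hA => hA
  continuousOn_invFun := (continuous_rotP (continuous_pi fun m =>
    (contDiff_affinePt i m).continuous) (affinePt_ne i)).continuousOn

theorem exists_mem_affineChart_source (A : P) : ∃ i, A ∈ (affineChart i).source := by
  obtain ⟨w, hw, rfl⟩ := exists_rotP A
  obtain ⟨i, hi⟩ := Function.ne_iff.1 hw
  refine ⟨i, ?_⟩
  have hi : w i ≠ 0 := hi
  have hn := sum_sq_ne hw
  change quatGram (rotP w hw).1 i i ≠ 0
  rw [quatGram_rotP]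
  positivity

/-- The charts of `P` are the three affine charts of the projective plane. -/
instance : ChartedSpace (EuclideanSpace ℝ (Fin 2)) P where
  atlas := range affineChart
  chartAt A := affineChart (exists_mem_affineChart_source A).choose
  mem_chart_source A := (exists_mem_affineChart_source A).choose_spec
  chart_mem_atlas _ := mem_range_self _

theorem contDiffOn_affineChart_trans (i j : Fin 3) :
    ContDiffOn ℝ ∞ ((affineChart i).symm.trans (affineChart j))
      ((affineChart i).symm.trans (affineChart j)).source := by
  rw [contDiffOn_euclidean]
  intro k
  have h : ∀ a ∈ ((affineChart i).symm.trans (affineChart j)).source, affinePt i a j ≠ 0 := by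
    intro a ha h0
    have h1 : quatGram (rotP (affinePt i a) (affinePt_ne i a)).1 j j ≠ 0 := ha.2
    rw [quatGram_rotP, h0] at h1
    simp at h1
  refine ContDiffOn.congr (f := fun a => affinePt i a (j.succAbove k) / affinePt i a j)
    ((contDiff_affinePt i _).contDiffOn.div (contDiff_affinePt i _).contDiffOn h) ?_
  intro a ha
  have ha := h a ha
  have hn := sum_sq_ne (affinePt_ne i a)
  change quatGram (rotP (affinePt i a) (affinePt_ne i a)).1 j (j.succAbove k) /
    quatGram (rotP (affinePt i a) (affinePt_ne i a)).1 j j = _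
  simp only [quatGram_rotP]
  field_simp

instance : IsManifold (𝓡 2) ∞ P := by
  apply isManifold_of_contDiffOn
  rintro _ _ ⟨i, rfl⟩ ⟨j, rfl⟩
  simpa using contDiffOn_affineChart_trans i j

/-! ### The nullhomotopy -/

/-- The rectangle `0 ≤ s ≤ π / 2`, `0 ≤ t ≤ 2π`. -/
abbrev Rect : Type := Icc (0 : ℝ) (Real.pi / 2) × Icc (0 : ℝ) (2 * Real.pi)

/-- The real, `I` and `K` coordinates of the quaternion
`(1 - 2 cos² s sin² (t/2)) + I (sin (2s) sin² (t/2)) + K (cos s sin t)`. -/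
def liftCoord (s t : ℝ) : Fin 3 → ℝ :=
  ![1 - 2 * Real.cos s ^ 2 * Real.sin (t / 2) ^ 2, Real.sin (2 * s) * Real.sin (t / 2) ^ 2,
    Real.cos s * Real.sin t]

theorem liftCoord_eq (s t : ℝ) : liftCoord s t =
    ![1 - 2 * (Real.cos s * Real.sin (t / 2)) ^ 2,
      2 * Real.sin s * Real.cos s * Real.sin (t / 2) ^ 2,
      2 * (Real.cos s * Real.sin (t / 2)) * Real.cos (t / 2)] := by
  have h1 : Real.sin t = 2 * Real.sin (t / 2) * Real.cos (t / 2) := by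
    rw [← Real.sin_two_mul]; congr 1; ring
  rw [liftCoord, h1, Real.sin_two_mul, mul_pow]
  ext i
  fin_cases i <;> simp <;> ring

theorem liftCoord_norm (s t : ℝ) :
    liftCoord s t 0 ^ 2 + liftCoord s t 1 ^ 2 + liftCoord s t 2 ^ 2 = 1 := by
  simp only [liftCoord_eq, Matrix.cons_val]
  linear_combination (4 * Real.cos s ^ 2 * Real.sin (t / 2) ^ 4) * Real.sin_sq_add_cos_sq s +
    (4 * Real.cos s ^ 2 * Real.sin (t / 2) ^ 2) * Real.sin_sq_add_cos_sq (t / 2)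

theorem liftCoord_ne (s t : ℝ) : liftCoord s t ≠ 0 := by
  intro h
  have := liftCoord_norm s t
  rw [h] at this
  norm_num at this

/-- The double-tipping nullhomotopy `D(s, t)` of the double-twist about the `z`-axis: conjugation
by the unit quaternion
`(1 - 2 cos² s sin² (t/2)) + I (sin (2s) sin² (t/2)) + K (cos s sin t)`. -/
def D (p : Rect) : SO3 :=
  rot (planeQuat (liftCoord p.1 p.2)) (planeQuat_ne (liftCoord_ne p.1 p.2))



/-- `D`, as a map of the rectangle into `P`. -/
def DP (p : Rect) : P := ⟨D p, rot_mem_P (liftCoord_ne p.1 p.2)⟩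

theorem DP_eq (p : Rect) : DP p = rotP (liftCoord p.1 p.2) (liftCoord_ne p.1 p.2) := rfl

theorem continuous_DP : Continuous DP := by
  refine continuous_rotP (w := fun p : Rect => liftCoord p.1 p.2) (continuous_pi fun i => ?_)
    fun p => liftCoord_ne p.1 p.2
  fin_cases i <;> simp [liftCoord] <;> fun_prop

theorem rotP_congr {w w' : Fin 3 → ℝ} {hw : w ≠ 0} {hw' : w' ≠ 0} (h : w = w') :
    rotP w hw = rotP w' hw' := by
  subst h; rfl

theorem rotP_congr_neg {w w' : Fin 3 → ℝ} {hw : w ≠ 0} {hw' : w' ≠ 0} (h : w = -w') :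
    rotP w hw = rotP w' hw' := by
  rw [← rotP_smul w' hw' (c := -1) (by norm_num)]
  exact rotP_congr (by simpa using h)

theorem eq_or_eq_neg_of_rotP {w w' : Fin 3 → ℝ} {hw : w ≠ 0} {hw' : w' ≠ 0}
    (h1 : w 0 ^ 2 + w 1 ^ 2 + w 2 ^ 2 = 1) (h1' : w' 0 ^ 2 + w' 1 ^ 2 + w' 2 ^ 2 = 1)
    (h : rotP w hw = rotP w' hw') : w = w' ∨ w = -w' := by
  have hg : ∀ i j, w i * w j = w' i * w' j := by
    intro i j
    have := congrArg (fun A : P => quatGram A.1 i j) h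
    simpa only [quatGram_rotP, h1, h1', div_one] using this
  obtain ⟨i, hi⟩ := Function.ne_iff.1 hw
  have hi : w i ≠ 0 := hi
  rcases mul_self_eq_mul_self_iff.1 (hg i i) with h2 | h2
  · left
    ext j
    exact mul_left_cancel₀ hi (by rw [hg i j, h2])
  · right
    ext j
    refine mul_left_cancel₀ hi ?_
    rw [hg i j, h2, Pi.neg_apply, neg_mul_neg]

/-- The three edges `t = 0`, `t = 2π` and `s = π / 2` of the rectangle. -/
def collapsedEdges : Set Rect :=
  {p | p.2.1 = 0 ∨ p.2.1 = 2 * Real.pi ∨ p.1.1 = Real.pi / 2}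

/-- The identifications defining `Q`: the three edges `t = 0`, `t = 2π`, `s = π / 2` are collapsed
to a point, and the edge `s = 0` is wrapped twice around itself. -/
inductive Glue : Rect → Rect → Prop
  | collapse (p q : Rect) (hp : p ∈ collapsedEdges) (hq : q ∈ collapsedEdges) : Glue p q
  | wrap (p q : Rect) (hp : p.1.1 = 0) (hq : q.1.1 = 0) (h : q.2.1 = p.2.1 + Real.pi) : Glue p q

/-- The quotient space `Q` of the rectangle (`Quot` takes the equivalence relation generated by
`Glue`), with the quotient topology. -/
def Q : Type := Quot Glue

instance : TopologicalSpace Q := inferInstanceAs (TopologicalSpace (Quot Glue))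

instance : CompactSpace Q := inferInstanceAs (CompactSpace (Quot Glue))

theorem liftCoord_collapsed {p : Rect} (hp : p ∈ collapsedEdges) :
    liftCoord p.1 p.2 = ![1, 0, 0] := by
  rw [liftCoord_eq]
  rcases hp with h | h | h
  · simp [h]
  · have : 2 * Real.pi / 2 = Real.pi := by ring
    simp [h, this]
  · simp [h]

theorem liftCoord_zero (t : ℝ) : liftCoord 0 t = ![Real.cos t, 0, Real.sin t] := by
  have h : Real.cos t = 1 - 2 * Real.sin (t / 2) ^ 2 := by
    rw [← Real.cos_two_mul_eq_one_sub]; congr 1; ring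
  rw [h]
  simp [liftCoord]

theorem DP_glue (p q : Rect) (h : Glue p q) : DP p = DP q := by
  cases h with
  | collapse hp hq =>
    exact rotP_congr (hw := liftCoord_ne _ _) (hw' := liftCoord_ne _ _)
      ((liftCoord_collapsed hp).trans (liftCoord_collapsed hq).symm)
  | wrap hp hq h =>
    refine rotP_congr_neg (hw := liftCoord_ne _ _) (hw' := liftCoord_ne _ _) ?_
    rw [hp, hq, h, liftCoord_zero, liftCoord_zero]
    simp

/-- The map `D̄ : Q → P` induced by `D`. -/
def Dbar : Q → P := Quot.lift DP DP_glue

theorem continuous_Dbar : Continuous Dbar := continuous_quot_lift DP_glue continuous_DP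

theorem exists_angle {c σ : ℝ} (h : c ^ 2 + σ ^ 2 = 1) (hσ : 0 ≤ σ) :
    ∃ s, 0 ≤ s ∧ s ≤ Real.pi ∧ (0 ≤ c → s ≤ Real.pi / 2) ∧ Real.cos s = c ∧ Real.sin s = σ := by
  refine ⟨Real.arccos c, Real.arccos_nonneg c, Real.arccos_le_pi c,
    Real.arccos_le_pi_div_two.2, Real.cos_arccos (by nlinarith) (by nlinarith), ?_⟩
  rw [Real.sin_arccos, show 1 - c ^ 2 = σ ^ 2 by linarith, Real.sqrt_sq hσ]

theorem exists_liftCoord {w : Fin 3 → ℝ} (h : w 0 ^ 2 + w 1 ^ 2 + w 2 ^ 2 = 1) (h1 : 0 ≤ w 1) :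
    ∃ p : Rect, liftCoord p.1 p.2 = w := by
  have hpi := Real.pi_pos
  rcases h1.eq_or_lt with h1 | h1
  · rw [← h1] at h
    rcases le_total 0 (w 2) with h2 | h2
    · obtain ⟨t, ht0, ht1, -, hc, hs⟩ := exists_angle (c := w 0) (σ := w 2) (by linarith) h2
      refine ⟨(⟨0, le_rfl, by positivity⟩, ⟨t, ht0, by linarith⟩), ?_⟩
      rw [liftCoord_zero, hc, hs]
      ext i
      fin_cases i <;> simp [h1]
    · obtain ⟨t, ht0, ht1, -, hc, hs⟩ := exists_angle (c := w 0) (σ := -w 2) (by linarith)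
        (by linarith)
      refine ⟨(⟨0, le_rfl, by positivity⟩, ⟨2 * Real.pi - t, by linarith, by linarith⟩), ?_⟩
      rw [liftCoord_zero, Real.cos_two_pi_sub, Real.sin_two_pi_sub, hc, hs]
      ext i
      fin_cases i <;> simp [h1]
  · have hr : w 0 < 1 := by nlinarith [sq_nonneg (w 2)]
    obtain ⟨k, hk, hk2⟩ : ∃ k, 0 < k ∧ k ^ 2 = (1 - w 0) / 2 :=
      ⟨√((1 - w 0) / 2), Real.sqrt_pos.2 (by linarith), Real.sq_sqrt (by linarith)⟩
    obtain ⟨S, hS, hS2⟩ : ∃ S, 0 < S ∧ S ^ 2 = k ^ 2 + (w 1 / (2 * k)) ^ 2 :=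
      ⟨√(k ^ 2 + (w 1 / (2 * k)) ^ 2), Real.sqrt_pos.2 (by positivity),
        Real.sq_sqrt (by positivity)⟩
    obtain ⟨τ, ht0, ht1, -, htc, hts⟩ := exists_angle (c := w 2 / (2 * k)) (σ := S) (by
      rw [hS2]; field_simp; nlinarith) hS.le
    obtain ⟨s, hs0, -, hs1, hsc, hss⟩ := exists_angle (c := k / S) (σ := w 1 / (2 * k) / S) (by
      rw [div_pow, div_pow _ S, ← add_div, ← hS2]; field_simp) (by positivity)
    refine ⟨(⟨s, hs0, hs1 (by positivity)⟩, ⟨2 * τ, by linarith, by linarith⟩), ?_⟩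
    have : 2 * τ / 2 = τ := by ring
    rw [liftCoord_eq]
    simp only [this, htc, hts, hsc, hss]
    ext i
    fin_cases i <;> simp <;> field_simp
    linarith

theorem surjective_Dbar : Function.Surjective Dbar := by
  intro A
  obtain ⟨w, hw, rfl⟩ := exists_rotP A
  have hpos : 0 < w 0 ^ 2 + w 1 ^ 2 + w 2 ^ 2 := lt_of_le_of_ne (by positivity) (sum_sq_ne hw).symm
  set N := √(w 0 ^ 2 + w 1 ^ 2 + w 2 ^ 2) with hN
  have hN0 : 0 < N := Real.sqrt_pos.2 hpos
  have hN2 : N ^ 2 = w 0 ^ 2 + w 1 ^ 2 + w 2 ^ 2 := Real.sq_sqrt hpos.le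
  obtain ⟨c, hc, hc2, hc1⟩ : ∃ c : ℝ, c ≠ 0 ∧ c ^ 2 * N ^ 2 = 1 ∧ 0 ≤ c * w 1 := by
    rcases le_total 0 (w 1) with h | h
    · exact ⟨N⁻¹, by positivity, by field_simp, by positivity⟩
    · refine ⟨-N⁻¹, by simpa using hN0.ne', by field_simp, ?_⟩
      exact mul_nonneg_of_nonpos_of_nonpos (by simpa using hN0.le) h
  obtain ⟨p, hp⟩ := exists_liftCoord (w := c • w) (by
    simp only [Pi.smul_apply, smul_eq_mul]; rw [← hc2, hN2]; ring) (by simpa using hc1)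
  refine ⟨Quot.mk _ p, ?_⟩
  rw [← rotP_smul w hw hc]
  exact rotP_congr (hw := liftCoord_ne _ _) hp

theorem mk_eq_of_zero {p q : Rect} (hp : p.1.1 = 0) (hq : q.1.1 = 0) (hle : p.2.1 ≤ q.2.1)
    (h : DP p = DP q) : (Quot.mk _ p : Q) = Quot.mk _ q := by
  have hpi := Real.pi_pos
  have h0 := eq_or_eq_neg_of_rotP (hw := liftCoord_ne _ _) (hw' := liftCoord_ne _ _)
    (liftCoord_norm _ _) (liftCoord_norm _ _) h
  rw [hp, hq, liftCoord_zero, liftCoord_zero] at h0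
  have hs : Real.sin (q.2.1 - p.2.1) = 0 := by
    rw [Real.sin_sub]
    rcases h0 with h0 | h0 <;> have e0 := congrFun h0 0 <;> have e2 := congrFun h0 2 <;>
      simp at e0 e2 <;> rw [e0, e2] <;> ring
  obtain ⟨n, hn⟩ := Real.sin_eq_zero_iff.1 hs
  have b1 := p.2.2
  have b2 := q.2.2
  have hn0 : (0 : ℝ) ≤ n := by
    by_contra! hc
    nlinarith
  have hn2 : (n : ℝ) ≤ 2 := by
    by_contra! hc
    nlinarith [b1.1, b2.2]
  have hn0 : 0 ≤ n := by exact_mod_cast hn0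
  have hn2 : n ≤ 2 := by exact_mod_cast hn2
  interval_cases n
  · congr 1
    refine Prod.ext (Subtype.ext (hp.trans hq.symm)) (Subtype.ext ?_)
    push_cast at hn
    linarith
  · refine Quot.sound (Glue.wrap p q hp hq ?_)
    push_cast at hn
    linarith
  · push_cast at hn
    exact Quot.sound (Glue.collapse p q (Or.inl (by linarith [b1.1, b2.2]))
      (Or.inr (Or.inl (by linarith [b1.1, b2.2]))))

theorem exists_mk_zero {p : Rect} (h : liftCoord p.1 p.2 1 = 0) :
    ∃ q : Rect, q.1.1 = 0 ∧ (Quot.mk _ p : Q) = Quot.mk _ q := by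
  have hpi := Real.pi_pos
  by_cases hp : p.1.1 = 0
  · exact ⟨p, hp, rfl⟩
  · refine ⟨(⟨0, le_rfl, by positivity⟩, ⟨0, le_rfl, by positivity⟩), rfl,
      Quot.sound (Glue.collapse _ _ ?_ (Or.inl rfl))⟩
    have b1 := p.1.2
    have b2 := p.2.2
    by_contra hcon
    simp only [collapsedEdges, mem_ofPred_eq, not_or] at hcon
    obtain ⟨c1, c2, c3⟩ := hcon
    have s0 : 0 < p.1.1 := lt_of_le_of_ne b1.1 (Ne.symm hp)
    have s1 : p.1.1 < Real.pi / 2 := lt_of_le_of_ne b1.2 c3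
    have t0 : 0 < p.2.1 := lt_of_le_of_ne b2.1 (Ne.symm c1)
    have t1 : p.2.1 < 2 * Real.pi := lt_of_le_of_ne b2.2 c2
    have x1 := Real.sin_pos_of_pos_of_lt_pi s0 (by linarith)
    have x2 := Real.cos_pos_of_mem_Ioo ⟨by linarith, s1⟩
    have x3 := Real.sin_pos_of_pos_of_lt_pi (x := p.2.1 / 2) (by linarith) (by linarith)
    rw [liftCoord_eq] at h
    simp only [Matrix.cons_val] at h
    have : 0 < 2 * Real.sin p.1 * Real.cos p.1 * Real.sin (p.2 / 2) ^ 2 := by positivity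
    linarith

theorem liftCoord_one_nonneg (p : Rect) : 0 ≤ liftCoord p.1 p.2 1 := by
  have b1 := p.1.2
  have x1 := Real.sin_nonneg_of_nonneg_of_le_pi b1.1 (by linarith [b1.2, Real.pi_pos])
  have x2 := Real.cos_nonneg_of_mem_Icc ⟨by linarith [b1.1, Real.pi_pos], b1.2⟩
  rw [liftCoord_eq]
  simp only [Matrix.cons_val]
  positivity

theorem eq_of_liftCoord_eq {p q : Rect} (hpos : 0 < liftCoord p.1 p.2 1)
    (h : liftCoord p.1 p.2 = liftCoord q.1 q.2) : p = q := by
  have hpi := Real.pi_pos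
  obtain ⟨⟨s, hs⟩, t, ht⟩ := p
  obtain ⟨⟨s', hs'⟩, t', ht'⟩ := q
  have e0 := congrFun h 0
  have e1 := congrFun h 1
  have e2 := congrFun h 2
  simp only [liftCoord_eq, Matrix.cons_val] at hpos e0 e1 e2
  have c0 := Real.cos_nonneg_of_mem_Icc ⟨by linarith [hs.1], hs.2⟩
  have c0' := Real.cos_nonneg_of_mem_Icc ⟨by linarith [hs'.1], hs'.2⟩
  have S0 := Real.sin_nonneg_of_nonneg_of_le_pi (x := t / 2) (by linarith [ht.1])
    (by linarith [ht.2])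
  have S0' := Real.sin_nonneg_of_nonneg_of_le_pi (x := t' / 2) (by linarith [ht'.1])
    (by linarith [ht'.2])
  have k : Real.cos s * Real.sin (t / 2) = Real.cos s' * Real.sin (t' / 2) :=
    (pow_left_inj₀ (by positivity) (by positivity) two_ne_zero).1 (by linarith)
  have kne : Real.cos s * Real.sin (t / 2) ≠ 0 := by
    intro h0
    have : 2 * Real.sin s * Real.cos s * Real.sin (t / 2) ^ 2 =
      2 * Real.sin s * Real.sin (t / 2) * (Real.cos s * Real.sin (t / 2)) := by ring
    rw [this, h0, mul_zero] at hpos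
    exact lt_irrefl _ hpos
  rw [← k] at e2
  have hC : Real.cos (t / 2) = Real.cos (t' / 2) :=
    mul_left_cancel₀ (mul_ne_zero two_ne_zero kne) e2
  have htt : t / 2 = t' / 2 := Real.injOn_cos ⟨by linarith [ht.1], by linarith [ht.2]⟩
    ⟨by linarith [ht'.1], by linarith [ht'.2]⟩ hC
  rw [← htt] at k
  have hcc : Real.cos s = Real.cos s' := mul_right_cancel₀ (right_ne_zero_of_mul kne) k
  have hss : s = s' := Real.injOn_cos ⟨hs.1, by linarith [hs.2]⟩ ⟨hs'.1, by linarith [hs'.2]⟩ hcc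
  have htt : t = t' := by linarith
  subst hss htt
  rfl

theorem injective_Dbar : Function.Injective Dbar := by
  rintro ⟨p⟩ ⟨q⟩ h
  have h : DP p = DP q := h
  have h0 := eq_or_eq_neg_of_rotP (hw := liftCoord_ne _ _) (hw' := liftCoord_ne _ _)
    (liftCoord_norm _ _) (liftCoord_norm _ _) h
  have np := liftCoord_one_nonneg p
  have nq := liftCoord_one_nonneg q
  rcases np.eq_or_lt with hp | hp
  · have hq : liftCoord q.1 q.2 1 = 0 := by
      rcases h0 with h0 | h0
      · linarith [congrFun h0 1]
      · have := congrFun h0 1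
        simp only [Pi.neg_apply] at this
        linarith
    obtain ⟨p', hp', ep⟩ := exists_mk_zero hp.symm
    obtain ⟨q', hq', eq⟩ := exists_mk_zero hq
    have h' : DP p' = DP q' := by
      have e1 : DP p = DP p' := congrArg Dbar ep
      have e2 : DP q = DP q' := congrArg Dbar eq
      rw [← e1, ← e2, h]
    refine ep.trans (Eq.trans ?_ eq.symm)
    rcases le_total p'.2.1 q'.2.1 with hle | hle
    · exact mk_eq_of_zero hp' hq' hle h'
    · exact (mk_eq_of_zero hq' hp' hle h'.symm).symm
  · rcases h0 with h0 | h0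
    · exact congrArg _ (eq_of_liftCoord_eq hp h0)
    · have := congrFun h0 1
      simp at this
      linarith

/-- `D̄` is a homeomorphism of `Q` onto `P`. -/
def DbarHomeo : Q ≃ₜ P :=
  Continuous.homeoOfEquivCompactToT2 (f := Equiv.ofBijective Dbar ⟨injective_Dbar, surjective_Dbar⟩)
    continuous_Dbar

instance : CompactSpace P := DbarHomeo.compactSpace

instance : T2Space Q := DbarHomeo.symm.t2Space

/-- The differentiable structure of `Q` making `D̄` a diffeomorphism: its charts are the charts
of `P` composed with `D̄`. -/
instance : ChartedSpace (EuclideanSpace ℝ (Fin 2)) Q where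
  atlas := (fun e => DbarHomeo.transOpenPartialHomeomorph e) ''
    atlas (EuclideanSpace ℝ (Fin 2)) P
  chartAt x := DbarHomeo.transOpenPartialHomeomorph (chartAt _ (Dbar x))
  mem_chart_source x := mem_chart_source (EuclideanSpace ℝ (Fin 2)) (Dbar x)
  chart_mem_atlas x := mem_image_of_mem _ (chart_mem_atlas _ (Dbar x))

instance : IsManifold (𝓡 2) ∞ Q := by
  apply isManifold_of_contDiffOn
  intro e e' he he'
  obtain ⟨_, ⟨i, rfl⟩, rfl⟩ := he
  obtain ⟨_, ⟨j, rfl⟩, rfl⟩ := he'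
  have h := contDiffOn_affineChart_trans i j
  have hs : (DbarHomeo.transOpenPartialHomeomorph (affineChart i)).symm.trans
      (DbarHomeo.transOpenPartialHomeomorph (affineChart j)) =
      (affineChart i).symm.trans (affineChart j) := by
    refine OpenPartialHomeomorph.ext _ _ (fun a => ?_) (fun a => ?_) ?_
    · simp
    · simp
    · ext a; simp
  simpa [hs] using h

/-- `D̄` as a diffeomorphism of `Q` onto `P`. -/
def DbarDiffeo : Q ≃ₘ^∞⟮𝓡 2, 𝓡 2⟯ P where
  toEquiv := Equiv.ofBijective Dbar ⟨injective_Dbar, surjective_Dbar⟩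
  contMDiff_toFun x := by
    rw [contMDiffAt_iff]
    have h : ∀ a, extChartAt (𝓡 2) (Dbar x) (Dbar ((extChartAt (𝓡 2) x).symm a)) = a := by
      intro a
      change affineChart _ (DbarHomeo (DbarHomeo.symm ((affineChart _).symm a))) = a
      rw [DbarHomeo.apply_symm_apply]
      exact (affineChart _).right_inv (mem_univ a)
    exact ⟨continuous_Dbar.continuousAt,
      contDiff_id.contDiffWithinAt.congr (fun a _ => h a) (h _)⟩
  contMDiff_invFun x := by
    rw [contMDiffAt_iff]
    have h : ∀ a, extChartAt (𝓡 2) (DbarHomeo.symm x)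
        (DbarHomeo.symm ((extChartAt (𝓡 2) x).symm a)) = a := by
      obtain ⟨y, rfl⟩ := DbarHomeo.surjective x
      intro a
      rw [DbarHomeo.symm_apply_apply]
      change affineChart _ (DbarHomeo (DbarHomeo.symm ((affineChart _).symm a))) = a
      rw [DbarHomeo.apply_symm_apply]
      exact (affineChart _).right_inv (mem_univ a)
    exact ⟨DbarHomeo.symm.continuous.continuousAt,
      contDiff_id.contDiffWithinAt.congr (fun a _ => h a) (h _)⟩

/-! ### Mod two degree -/

/-- `y` is a regular value of `f`: the differential of `f` is surjective at every point of the
preimage of `y`. -/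
def IsRegularValue (n : ℕ) {M N : Type*} [TopologicalSpace M]
    [ChartedSpace (EuclideanSpace ℝ (Fin n)) M] [TopologicalSpace N]
    [ChartedSpace (EuclideanSpace ℝ (Fin n)) N] (f : M → N) (y : N) : Prop :=
  ∀ x, f x = y → Function.Surjective (mfderiv (𝓡 n) (𝓡 n) f x)

/-- A smooth map `f : M → N` between closed `n`-manifolds, `N` connected, has mod two degree `d`:
regular values exist, and for every regular value `y` the number of points of `f⁻¹(y)` is finite
and congruent to `d` modulo two. -/
structure HasModTwoDegree (n : ℕ) {M N : Type*} [TopologicalSpace M] [CompactSpace M] [T2Space M]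
    [ChartedSpace (EuclideanSpace ℝ (Fin n)) M] [IsManifold (𝓡 n) ∞ M]
    [TopologicalSpace N] [CompactSpace N] [T2Space N] [ConnectedSpace N]
    [ChartedSpace (EuclideanSpace ℝ (Fin n)) N] [IsManifold (𝓡 n) ∞ N]
    (f : M → N) (d : ZMod 2) : Prop where
  contMDiff : ContMDiff (𝓡 n) (𝓡 n) ∞ f
  exists_isRegularValue : ∃ y, IsRegularValue n f y
  card_preimage : ∀ y, IsRegularValue n f y →
    (f ⁻¹' {y}).Finite ∧ ((f ⁻¹' {y}).ncard : ZMod 2) = d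

/-- `f` has nonzero mod two degree. -/
def HasNonzeroModTwoDegree (n : ℕ) {M N : Type*} [TopologicalSpace M] [CompactSpace M] [T2Space M]
    [ChartedSpace (EuclideanSpace ℝ (Fin n)) M] [IsManifold (𝓡 n) ∞ M]
    [TopologicalSpace N] [CompactSpace N] [T2Space N] [ConnectedSpace N]
    [ChartedSpace (EuclideanSpace ℝ (Fin n)) N] [IsManifold (𝓡 n) ∞ N]
    (f : M → N) : Prop :=
  ∃ d : ZMod 2, d ≠ 0 ∧ HasModTwoDegree n f d

end DoubleTwist

end

noncomputable section

namespace DoubleTwist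

/-! ### Rotations taking `v` to `y` as intertwining quaternions -/

/-! Conjugation by a nonzero quaternion `q` takes `v` to `y` exactly when `q v = y q`, a condition
linear in `q` (`evalAt_rotP_eq_iff`). Its solutions in the quaternions form a real plane `q₀ (ℝ + ℝ
v)`, because `q₀⁻¹ q` commutes with `v` (`Intertwines.exists_eq_mul`). The fibre of the evaluation
map over `y` is the projectivisation of the intersection of this plane with the 3-dimensional span
of `1, I, K`.

By dimension the intersection is never zero (`exists_intertwines_planeQuat`). It is a line unless it
contains the whole plane, and this happens only for `y = reflY v`
(`imJ_mul_sphereQuat_eq_zero_iff`). So every `y ≠ reflY v` has exactly one preimage.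

The same linear algebra governs the differential. Differentiating `q v = y q` along `q + t p` gives
`p v = y' q + y p`, so `p` is in the kernel precisely when `p` also intertwines `v` and `y`
(`fderiv_evalAffine_eq_zero_iff`). In an affine chart a nonzero `p` is independent of `q`, so the
differential degenerates only over `reflY v` (`surjective_mfderiv_evalAt_iff`). The regular values
are thus exactly the points other than `reflY v`. The diffeomorphism `DbarDiffeo` carries everything
over to `Q`. -/

theorem pureQuat_re (v : Fin 3 → ℝ) : (pureQuat v).re = 0 := rfl
theorem pureQuat_imI (v : Fin 3 → ℝ) : (pureQuat v).imI = v 0 := rfl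
theorem pureQuat_imJ (v : Fin 3 → ℝ) : (pureQuat v).imJ = v 1 := rfl
theorem pureQuat_imK (v : Fin 3 → ℝ) : (pureQuat v).imK = v 2 := rfl

theorem pureQuat_injective : Function.Injective pureQuat := by
  intro v w h
  rw [Quaternion.ext_iff] at h
  ext i
  fin_cases i
  · exact h.2.1
  · exact h.2.2.1
  · exact h.2.2.2

/-- A point of the sphere as a pure quaternion. -/
def sphereQuat (v : S2) : ℍ[ℝ] := pureQuat v.1.ofLp

theorem sphereQuat_injective : Function.Injective sphereQuat := fun _ _ h =>
  Subtype.ext (WithLp.ofLp_injective 2 (pureQuat_injective h))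

@[simp] theorem sphereQuat_re (v : S2) : (sphereQuat v).re = 0 := rfl
theorem sum_sq_sphereQuat (v : S2) :
    (sphereQuat v).imI ^ 2 + (sphereQuat v).imJ ^ 2 + (sphereQuat v).imK ^ 2 = 1 := by
  have h : ‖v.1‖ ^ 2 = 1 := by rw [mem_sphere_zero_iff_norm.1 v.2, one_pow]
  rw [EuclideanSpace.norm_sq_eq, Fin.sum_univ_three] at h
  simp only [Real.norm_eq_abs, sq_abs] at h
  exact h

@[simp] theorem planeQuat_re (w : Fin 3 → ℝ) : (planeQuat w).re = w 0 := rfl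
@[simp] theorem planeQuat_imI (w : Fin 3 → ℝ) : (planeQuat w).imI = w 1 := rfl
@[simp] theorem planeQuat_imJ (w : Fin 3 → ℝ) : (planeQuat w).imJ = 0 := rfl
@[simp] theorem planeQuat_imK (w : Fin 3 → ℝ) : (planeQuat w).imK = w 2 := rfl

theorem planeQuat_injective : Function.Injective planeQuat := by
  intro v w h
  rw [Quaternion.ext_iff] at h
  ext i
  fin_cases i
  · exact h.1
  · exact h.2.1
  · exact h.2.2.2

theorem exists_planeQuat {q : ℍ[ℝ]} (h : q.imJ = 0) : ∃ w, planeQuat w = q :=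
  ⟨![q.re, q.imI, q.imK], by ext <;> simp [h]⟩

theorem planeQuat_add (w w' : Fin 3 → ℝ) : planeQuat (w + w') = planeQuat w + planeQuat w' := by
  ext <;> simp

theorem planeQuat_smul (c : ℝ) (w : Fin 3 → ℝ) : planeQuat (c • w) = c • planeQuat w := by
  ext <;> simp

theorem sphereQuat_mul_self (v : S2) : sphereQuat v * sphereQuat v = -1 := by
  have h := sum_sq_sphereQuat v
  ext <;> simp <;> linarith

theorem pureQuat_conjMatrix_mulVec {q : ℍ[ℝ]} (hq : q ≠ 0) (v : Fin 3 → ℝ) :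
    pureQuat (conjMatrix q *ᵥ v) = q * pureQuat v * q⁻¹ := by
  have hn := normSq_ne hq
  have h : q⁻¹ = (q.re ^ 2 + q.imI ^ 2 + q.imJ ^ 2 + q.imK ^ 2)⁻¹ • star q := by
    rw [← Quaternion.normSq_def']; rfl
  rw [conjMatrix_eq, h]
  ext <;> simp [pureQuat_re, pureQuat_imI, pureQuat_imJ, pureQuat_imK, dotProduct, Fin.sum_univ_three]
  · exact Or.inr (by ring)
  all_goals field_simp; ring

/-! ### The real plane of quaternions intertwining two points of the sphere -/

/-- The quaternions `q` with `q v = y q`; the nonzero ones are those whose conjugation takes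
`v` to `y`. -/
def Intertwines (v y : S2) (q : ℍ[ℝ]) : Prop := q * sphereQuat v = sphereQuat y * q

/-- Clearing the inverse in `q v q⁻¹ = y` turns a condition on rotations into a linear condition on
quaternions. -/
theorem evalAt_rotP_eq_iff {v y : S2} {w : Fin 3 → ℝ} (hw : w ≠ 0) :
    evalAt v (rotP w hw).1 = y ↔ Intertwines v y (planeQuat w) := by
  have hq := planeQuat_ne hw
  have h : sphereQuat (evalAt v (rotP w hw).1) = planeQuat w * sphereQuat v * (planeQuat w)⁻¹ :=
    pureQuat_conjMatrix_mulVec hq _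
  rw [← sphereQuat_injective.eq_iff, h, Intertwines, mul_inv_eq_iff_eq_mul₀ hq]

/-- The commutator of two quaternions is twice the cross product of their imaginary parts, so the
imaginary part of `p` is parallel to `v`. -/
theorem exists_of_commute_sphereQuat {v : S2} {p : ℍ[ℝ]}
    (h : p * sphereQuat v = sphereQuat v * p) :
    ∃ α β : ℝ, p = α • (1 : ℍ[ℝ]) + β • sphereQuat v := by
  have hv := sum_sq_sphereQuat v
  have h1 := congrArg QuaternionAlgebra.imI h
  have h2 := congrArg QuaternionAlgebra.imJ h
  have h3 := congrArg QuaternionAlgebra.imK h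
  simp at h1 h2 h3
  -- As `v` has norm one, the coefficient along `v` is the inner product of the imaginary part of
  -- `p` with `v`.
  refine ⟨p.re, p.imI * (sphereQuat v).imI + p.imJ * (sphereQuat v).imJ + p.imK * (sphereQuat v).imK, ?_⟩
  ext <;> simp <;> grind

/-- The quotient `q⁻¹ q'` of two solutions commutes with `v`, hence lies in `ℝ + ℝ v`. -/
theorem Intertwines.exists_eq_mul {v y : S2} {q q' : ℍ[ℝ]} (hq : q ≠ 0) (h : Intertwines v y q)
    (h' : Intertwines v y q') :
    ∃ α β : ℝ, q' = α • q + β • (q * sphereQuat v) := by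
  have hinv : sphereQuat v * q⁻¹ = q⁻¹ * sphereQuat y := by
    rw [← mul_right_inj' hq, ← mul_left_inj' hq]
    simp only [mul_assoc, inv_mul_cancel₀ hq, mul_one, mul_inv_cancel_left₀ hq]
    exact h
  obtain ⟨α, β, e⟩ := exists_of_commute_sphereQuat (v := v) (p := q⁻¹ * q') (by
    rw [← mul_assoc, hinv, mul_assoc, mul_assoc, h'])
  refine ⟨α, β, ?_⟩
  rw [← mul_inv_cancel_left₀ hq q', e, mul_add, mul_smul_comm, mul_smul_comm, mul_one]

theorem Intertwines.mul_sphereQuat {v y : S2} {q : ℍ[ℝ]} (h : Intertwines v y q) :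
    Intertwines v y (q * sphereQuat v) := by
  unfold Intertwines at *
  rw [← mul_assoc, ← h]

theorem Intertwines.add {v y : S2} {q q' : ℍ[ℝ]} (h : Intertwines v y q)
    (h' : Intertwines v y q') : Intertwines v y (q + q') := by
  unfold Intertwines at *
  rw [add_mul, mul_add, h, h']

theorem Intertwines.smul {v y : S2} {q : ℍ[ℝ]} (c : ℝ) (h : Intertwines v y q) :
    Intertwines v y (c • q) := by
  unfold Intertwines at *
  rw [smul_mul_assoc, mul_smul_comm, h]

/-! ### Intersecting the plane of solutions with the span of `1, I, K` -/

/-- The reflection of the sphere in the `x`-`z` plane. -/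
def reflY (v : S2) : S2 := ⟨!₂[v.1 0, -v.1 1, v.1 2], by
  rw [mem_sphere_zero_iff_norm, EuclideanSpace.norm_eq, Fin.sum_univ_three]
  have h : v.1 0 ^ 2 + v.1 1 ^ 2 + v.1 2 ^ 2 = 1 := sum_sq_sphereQuat v
  simpa using h⟩

@[simp] theorem sphereQuat_reflY_imI (v : S2) :
    (sphereQuat (reflY v)).imI = (sphereQuat v).imI := rfl
@[simp] theorem sphereQuat_reflY_imJ (v : S2) :
    (sphereQuat (reflY v)).imJ = -(sphereQuat v).imJ := rfl
@[simp] theorem sphereQuat_reflY_imK (v : S2) :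
    (sphereQuat (reflY v)).imK = (sphereQuat v).imK := rfl

/-- The anti-automorphism of the quaternions fixing `I` and `K` and negating `J` shows that a
quaternion `w₀ + w₁ I + w₂ K` intertwining `v` and `y` remains in the span of `1, I, K` after
multiplication by `v` only if `y` is the reflection of `v`. -/
theorem imJ_mul_sphereQuat_eq_zero_iff {v y : S2} {w : Fin 3 → ℝ} (hw : w ≠ 0)
    (h : Intertwines v y (planeQuat w)) :
    (planeQuat w * sphereQuat v).imJ = 0 ↔ y = reflY v := by
  -- The anti-automorphism sends `w v` to `reflY v * w`, and its fixed points are the quaternions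
  -- without `J` component.
  have key : (planeQuat w * sphereQuat v).imJ = 0 ↔
      planeQuat w * sphereQuat v = sphereQuat (reflY v) * planeQuat w := by
    rw [Quaternion.ext_iff]
    simp
    grind
  rw [key, h, mul_left_inj' (planeQuat_ne hw), sphereQuat_injective.eq_iff]

/-- Write the second solution as `α w + β w v`. Its `J` component is `β` times that of `w v`, which
is nonzero away from the reflection of `v`, so `β = 0`. -/
theorem Intertwines.eq_smul {v y : S2} (hy : y ≠ reflY v) {w w' : Fin 3 → ℝ} (hw : w ≠ 0)
    (h : Intertwines v y (planeQuat w)) (h' : Intertwines v y (planeQuat w')) :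
    ∃ c : ℝ, w' = c • w := by
  obtain ⟨α, β, e⟩ := Intertwines.exists_eq_mul (planeQuat_ne hw) h h'
  have hJ := congrArg QuaternionAlgebra.imJ e
  have hne := mt (imJ_mul_sphereQuat_eq_zero_iff hw h).1 hy
  have hβ : β = 0 := by
    rw [Quaternion.imJ_add, Quaternion.imJ_smul, Quaternion.imJ_smul, planeQuat_imJ, planeQuat_imJ,
      smul_zero, zero_add] at hJ
    exact (mul_eq_zero.1 hJ.symm).resolve_right hne
  refine ⟨α, planeQuat_injective ?_⟩
  rw [e, hβ, zero_smul, add_zero, planeQuat_smul]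

theorem exists_intertwines_not_smul {v : S2} {w : Fin 3 → ℝ} (hw : w ≠ 0)
    (h : Intertwines v (reflY v) (planeQuat w)) :
    ∃ w', Intertwines v (reflY v) (planeQuat w') ∧ ∀ c : ℝ, w' ≠ c • w := by
  -- The second solution is `w v` itself. Were it `c w`, then `v` would be the real number `c`,
  -- contradicting `v² = -1`.
  obtain ⟨w', e⟩ := exists_planeQuat ((imJ_mul_sphereQuat_eq_zero_iff hw h).2 rfl)
  refine ⟨w', e ▸ h.mul_sphereQuat, ?_⟩
  rintro c rfl
  have h1 : sphereQuat v = c • (1 : ℍ[ℝ]) := by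
    rw [← mul_right_inj' (planeQuat_ne hw), ← e, planeQuat_smul, mul_smul_comm, mul_one]
  have h2 := sphereQuat_mul_self v
  rw [h1] at h2
  have := congrArg QuaternionAlgebra.re h2
  simp at this
  nlinarith

/-- The quaternion `1 - y v` works, since `(1 - y v) v = v + y = y (1 - y v)`. It vanishes only for
`y = -v`, where a half-turn about an axis orthogonal to `v` serves instead. -/
theorem exists_intertwines (v y : S2) : ∃ q : ℍ[ℝ], q ≠ 0 ∧ Intertwines v y q := by
  have hv := sphereQuat_mul_self v
  have hy := sphereQuat_mul_self y
  by_cases h : sphereQuat y * sphereQuat v = 1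
  · have hyv : sphereQuat y = -sphereQuat v := by
      have : sphereQuat y * sphereQuat v * sphereQuat v = sphereQuat v := by rw [h, one_mul]
      rw [mul_assoc, hv, mul_neg, mul_one] at this
      rw [← this, neg_neg]
    -- A pure quaternion orthogonal to `v` anticommutes with it; here the axis is also taken in the
    -- `x`-`z` plane.
    obtain ⟨a, b, hab, h0⟩ : ∃ a b : ℝ, ¬ (a = 0 ∧ b = 0) ∧ a * (sphereQuat v).imI + b * (sphereQuat v).imK = 0 := by
      by_cases h0 : (sphereQuat v).imI = 0 ∧ (sphereQuat v).imK = 0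
      · exact ⟨1, 0, by simp, by simp [h0.1]⟩
      · exact ⟨-(sphereQuat v).imK, (sphereQuat v).imI, fun h => h0 ⟨h.2, by linarith [h.1]⟩, by ring⟩
    refine ⟨planeQuat ![0, a, b], fun hz => hab ⟨?_, ?_⟩, ?_⟩
    · exact congrArg QuaternionAlgebra.imI hz
    · exact congrArg QuaternionAlgebra.imK hz
    · unfold Intertwines
      rw [hyv]
      ext <;> simp <;> linarith
  · refine ⟨1 - sphereQuat y * sphereQuat v, sub_ne_zero.2 (Ne.symm h), ?_⟩
    unfold Intertwines
    rw [sub_mul, mul_sub, mul_assoc, hv, ← mul_assoc, hy]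
    simp only [one_mul, mul_one, neg_mul, mul_neg, sub_neg_eq_add]
    abel

theorem exists_intertwines_planeQuat (v y : S2) :
    ∃ w : Fin 3 → ℝ, w ≠ 0 ∧ Intertwines v y (planeQuat w) := by
  obtain ⟨q, hq, h⟩ := exists_intertwines v y
  suffices H : ∃ q : ℍ[ℝ], q ≠ 0 ∧ q.imJ = 0 ∧ Intertwines v y q by
    obtain ⟨q, hq, hJ, h⟩ := H
    obtain ⟨w, rfl⟩ := exists_planeQuat hJ
    exact ⟨w, fun hw => hq (by subst hw; ext <;> simp), h⟩
  by_cases hJ : q.imJ = 0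
  · exact ⟨q, hq, hJ, h⟩
  -- The `J` component is a linear form on the plane spanned by `q` and `q v`; this combination lies
  -- in its kernel.
  · refine ⟨(q * sphereQuat v).imJ • q + (-q.imJ) • (q * sphereQuat v), ?_, ?_,
      (h.smul _).add (h.mul_sphereQuat.smul _)⟩
    · intro h0
      -- After cancelling `q`, a real number plus a nonzero multiple of `v` vanishes, which forces
      -- `v = 0`.
      have h1 : q * ((q * sphereQuat v).imJ • 1 + (-q.imJ) • sphereQuat v) = 0 := by
        rw [← h0, mul_add, mul_smul_comm, mul_smul_comm, mul_one]
      have h2 := (mul_eq_zero.1 h1).resolve_left hq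
      generalize (q * sphereQuat v).imJ = c at h2
      have e1 := congrArg QuaternionAlgebra.imI h2
      have e2 := congrArg QuaternionAlgebra.imJ h2
      have e3 := congrArg QuaternionAlgebra.imK h2
      simp [hJ] at e1 e2 e3
      have := sum_sq_sphereQuat v
      simp [e1, e2, e3] at this
    · simp only [Quaternion.imJ_add, Quaternion.imJ_smul, smul_eq_mul]
      ring

/-! ### Fibres of the evaluation map on `P` -/

theorem exists_evalAt_eq (v y : S2) : ∃ A : P, evalAt v A = y := by
  obtain ⟨w, hw, h⟩ := exists_intertwines_planeQuat v y
  exact ⟨rotP w hw, (evalAt_rotP_eq_iff hw).2 h⟩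

theorem evalAt_injective_of_ne {v y : S2} (hy : y ≠ reflY v) {A B : P} (hA : evalAt v A = y)
    (hB : evalAt v B = y) : A = B := by
  obtain ⟨w, hw, rfl⟩ := exists_rotP A
  obtain ⟨w', hw', rfl⟩ := exists_rotP B
  obtain ⟨c, rfl⟩ := Intertwines.eq_smul hy hw ((evalAt_rotP_eq_iff hw).1 hA)
    ((evalAt_rotP_eq_iff hw').1 hB)
  exact (rotP_smul w hw (left_ne_zero_of_smul hw')).symm

/-! ### The differential of the evaluation map in the affine charts -/

/-- The vector of `ℝ³` whose `i`-th coordinate is `0` and whose other coordinates are `h`. -/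
def affineDir (i : Fin 3) (h : EuclideanSpace ℝ (Fin 2)) : Fin 3 → ℝ :=
  i.insertNth (α := fun _ => ℝ) 0 h.ofLp

theorem affineDir_self (i : Fin 3) (h : EuclideanSpace ℝ (Fin 2)) : affineDir i h i = 0 := by
  simp [affineDir]

theorem affineDir_succAbove (i : Fin 3) (h : EuclideanSpace ℝ (Fin 2)) (k : Fin 2) :
    affineDir i h (i.succAbove k) = h k := by
  simp [affineDir]

theorem exists_affineDir {i : Fin 3} {w : Fin 3 → ℝ} (hw : w i = 0) : ∃ h, affineDir i h = w := by
  refine ⟨WithLp.toLp 2 fun k => w (i.succAbove k), ?_⟩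
  ext m
  rcases Fin.eq_self_or_eq_succAbove i m with rfl | ⟨k, rfl⟩
  · rw [affineDir_self, hw]
  · rw [affineDir_succAbove]

theorem affineDir_eq_zero_iff {i : Fin 3} {h : EuclideanSpace ℝ (Fin 2)} :
    affineDir i h = 0 ↔ h = 0 := by
  constructor
  · intro h0
    ext k
    rw [← affineDir_succAbove i h k, h0]
    rfl
  · rintro rfl
    ext m
    rcases Fin.eq_self_or_eq_succAbove i m with rfl | ⟨k, rfl⟩
    · rw [affineDir_self]; rfl
    · rw [affineDir_succAbove]; rfl

theorem affinePt_add_smul (i : Fin 3) (a h : EuclideanSpace ℝ (Fin 2)) (t : ℝ) :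
    affinePt i (a + t • h) = affinePt i a + t • affineDir i h := by
  ext m
  rcases Fin.eq_self_or_eq_succAbove i m with rfl | ⟨k, rfl⟩
  · simp [affinePt_self, affineDir_self]
  · simp [affinePt, affineDir]

/-- The evaluation map at `v`, read in the `i`-th affine chart of `P`, as a map to `ℝ³`. -/
def evalAffine (v : S2) (i : Fin 3) (a : EuclideanSpace ℝ (Fin 2)) : EuclideanSpace ℝ (Fin 3) :=
  (evalAt v (rotP (affinePt i a) (affinePt_ne i a)).1).1

theorem contDiff_evalAffine (v : S2) (i : Fin 3) : ContDiff ℝ ∞ (evalAffine v i) := by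
  have hc := contDiff_affinePt i
  have hN : ContDiff ℝ ∞ fun a : EuclideanSpace ℝ (Fin 2) =>
      (affinePt i a 0 ^ 2 + affinePt i a 1 ^ 2 + affinePt i a 2 ^ 2)⁻¹ :=
    ContDiff.inv ((((hc 0).pow 2).add ((hc 1).pow 2)).add ((hc 2).pow 2))
      fun a => sum_sq_ne (affinePt_ne i a)
  rw [contDiff_euclidean]
  intro m
  simp only [evalAffine, evalAt, rotP, rot, conjMatrix_planeQuat, Matrix.smul_mulVec]
  have h0 := hc 0
  have h1 := hc 1
  have h2 := hc 2
  refine hN.mul ?_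
  fin_cases m <;> simp [Matrix.mulVec, dotProduct, Fin.sum_univ_three] <;> fun_prop

theorem continuous_coe_evalAt (v : S2) :
    Continuous fun A : P => ((evalAt v A : S2) : EuclideanSpace ℝ (Fin 3)) := by
  refine (PiLp.continuous_toLp 2 _).comp ?_
  exact Continuous.matrix_mulVec (continuous_subtype_val.comp continuous_subtype_val)
    continuous_const

theorem contMDiff_coe_evalAt (v : S2) : ContMDiff (𝓡 2) 𝓘(ℝ, EuclideanSpace ℝ (Fin 3)) ∞
    fun A : P => ((evalAt v A : S2) : EuclideanSpace ℝ (Fin 3)) := by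
  intro A
  rw [contMDiffAt_iff]
  -- In the chart at `A`, the map is `evalAffine` by definition.
  exact ⟨(continuous_coe_evalAt v).continuousAt, (contDiff_evalAffine v _).contDiffWithinAt⟩

theorem contMDiff_evalAt (v : S2) : ContMDiff (𝓡 2) (𝓡 2) ∞ fun A : P => evalAt v A := by
  have : Fact (Module.finrank ℝ (EuclideanSpace ℝ (Fin 3)) = 2 + 1) :=
    ⟨finrank_euclideanSpace_fin⟩
  exact (contMDiff_coe_evalAt v).codRestrict_sphere fun A => (evalAt v A).2

/-- The inclusion of the sphere in `ℝ³` is an immersion, so composing with it leaves the kernel of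
the differential unchanged. This replaces charts of the sphere by an ordinary derivative into `ℝ³`.
-/
theorem exists_mfderiv_evalAt_eq_zero_iff (v : S2) (A : P) :
    ∃ i a, A = rotP (affinePt i a) (affinePt_ne i a) ∧ ∀ h : EuclideanSpace ℝ (Fin 2),
      (mfderiv (𝓡 2) (𝓡 2) (fun A : P => evalAt v A) A : EuclideanSpace ℝ (Fin 2) →L[ℝ]
        EuclideanSpace ℝ (Fin 2)) h = 0 ↔ fderiv ℝ (evalAffine v i) a h = 0 := by
  have : Fact (Module.finrank ℝ (EuclideanSpace ℝ (Fin 3)) = 2 + 1) :=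
    ⟨finrank_euclideanSpace_fin⟩
  -- This is the choice made in the charted space structure, so `chartAt` at `A` is `affineChart i`
  -- by definition.
  set i := (exists_mem_affineChart_source A).choose
  have hi : A ∈ (affineChart i).source := (exists_mem_affineChart_source A).choose_spec
  refine ⟨i, affineChart i A, ((affineChart i).left_inv hi).symm, fun h => ?_⟩
  have hcoe : mfderiv (𝓡 2) 𝓘(ℝ, EuclideanSpace ℝ (Fin 3))
      (fun A : P => ((evalAt v A : S2) : EuclideanSpace ℝ (Fin 3))) A =
      fderiv ℝ (evalAffine v i) (affineChart i A) := by
    rw [((contMDiff_coe_evalAt v A).mdifferentiableAt (by simp)).mfderiv]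
    simp only [modelWithCornersSelf_coe, range_id, fderivWithin_univ]
    rfl
  have hcomp : mfderiv (𝓡 2) 𝓘(ℝ, EuclideanSpace ℝ (Fin 3))
      (fun A : P => ((evalAt v A : S2) : EuclideanSpace ℝ (Fin 3))) A =
      (mfderiv (𝓡 2) 𝓘(ℝ, EuclideanSpace ℝ (Fin 3))
        ((↑) : S2 → EuclideanSpace ℝ (Fin 3)) (evalAt v A)).comp
        (mfderiv (𝓡 2) (𝓡 2) (fun A : P => evalAt v A) A) :=
    mfderiv_comp A ((contMDiff_coe_sphere (m := ∞) _).mdifferentiableAt (by simp))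
      ((contMDiff_evalAt v A).mdifferentiableAt (by simp))
  rw [← hcoe, hcomp]
  have hinj := injective_mvfderiv_subtypeVal_sphere (n := 2) (evalAt v A)
  exact (map_eq_zero_iff _ hinj).symm

/-- The inclusion of `ℝ³` into the quaternions as a continuous linear map. -/
def pureQuatCLM : EuclideanSpace ℝ (Fin 3) →L[ℝ] ℍ[ℝ] :=
  LinearMap.toContinuousLinearMap
    { toFun := fun x => pureQuat x.ofLp
      map_add' := fun x y => by
        rw [Quaternion.ext_iff]
        simp [pureQuat_re, pureQuat_imI, pureQuat_imJ, pureQuat_imK]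
      map_smul' := fun c x => by
        rw [Quaternion.ext_iff]
        simp [pureQuat_re, pureQuat_imI, pureQuat_imJ, pureQuat_imK] }

theorem pureQuatCLM_injective : Function.Injective pureQuatCLM := fun _ _ h =>
  WithLp.ofLp_injective 2 (pureQuat_injective h)

/-- Differentiating `q(a + t h) v = y(t) q(a + t h)` at `t = 0`. -/
theorem fderiv_evalAffine_eq_zero_iff (v : S2) (i : Fin 3) (a h : EuclideanSpace ℝ (Fin 2)) :
    fderiv ℝ (evalAffine v i) a h = 0 ↔
      Intertwines v (evalAt v (rotP (affinePt i a) (affinePt_ne i a)).1)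
        (planeQuat (affineDir i h)) := by
  set q := planeQuat (affinePt i a) with hq
  set p := planeQuat (affineDir i h) with hp
  set y := evalAt v (rotP (affinePt i a) (affinePt_ne i a)).1 with hy
  have hline : HasDerivAt (fun t : ℝ => q + t • p) p 0 := by
    simpa using ((hasDerivAt_id (0 : ℝ)).smul_const p).const_add q
  have hF : HasDerivAt (fun t : ℝ => pureQuatCLM (evalAffine v i (a + t • h)))
      (pureQuatCLM (fderiv ℝ (evalAffine v i) a h)) 0 :=
    pureQuatCLM.hasFDerivAt.comp_hasDerivAt (0 : ℝ)
      (((contDiff_evalAffine v i).differentiable (by simp) a).hasFDerivAt.hasLineDerivAt h)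
  have h0 : pureQuatCLM (evalAffine v i (a + (0 : ℝ) • h)) = sphereQuat y := by
    rw [zero_smul, add_zero]
    rfl
  have heq : (fun t : ℝ => (q + t • p) * sphereQuat v) =
      fun t : ℝ => pureQuatCLM (evalAffine v i (a + t • h)) * (q + t • p) := by
    ext1 t
    rw [hq, hp, ← planeQuat_smul, ← planeQuat_add, ← affinePt_add_smul]
    exact (evalAt_rotP_eq_iff (affinePt_ne i _)).1 rfl
  -- Comparing the derivatives of both sides gives `p v = y' q + y p`. As `q ≠ 0`, the term `y' q`
  -- vanishes exactly when `y'` does.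
  have hd := (hline.mul_const (sphereQuat v)).unique ((hF.mul hline).congr_of_eventuallyEq
    (Filter.Eventually.of_forall (congrFun heq)))
  rw [h0, zero_smul, add_zero] at hd
  rw [Intertwines, hd, add_eq_right, mul_eq_zero_iff_right (planeQuat_ne (affinePt_ne i a)),
    map_eq_zero_iff _ pureQuatCLM_injective]

/-- Source and target have equal dimension, so surjectivity means trivial kernel. The kernel
consists of the solutions with `i`-th coordinate `0`, while the base point is a solution with `i`-th
coordinate `1`; a nonzero kernel vector therefore exists exactly when the solutions in the span of
`1, I, K` form more than a line. -/
theorem surjective_mfderiv_evalAt_iff (v : S2) (A : P) :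
    Function.Surjective (mfderiv (𝓡 2) (𝓡 2) (fun A : P => evalAt v A) A) ↔
      evalAt v A ≠ reflY v := by
  obtain ⟨i, a, hA, hker⟩ := exists_mfderiv_evalAt_eq_zero_iff v A
  have hsurj : Function.Surjective (mfderiv (𝓡 2) (𝓡 2) (fun A : P => evalAt v A) A) ↔
      ∀ h, affineDir i h ≠ 0 → ¬ Intertwines v (evalAt v A) (planeQuat (affineDir i h)) := by
    set L : EuclideanSpace ℝ (Fin 2) →L[ℝ] EuclideanSpace ℝ (Fin 2) :=
      mfderiv (𝓡 2) (𝓡 2) (fun A : P => evalAt v A) A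
    change Function.Surjective L.toLinearMap ↔ _
    rw [← LinearMap.injective_iff_surjective, injective_iff_map_eq_zero]
    refine forall_congr' fun h => ?_
    rw [hA, ← fderiv_evalAffine_eq_zero_iff, ← hker, Ne, affineDir_eq_zero_iff, not_imp_not]
    rfl
  have hw := affinePt_ne i a
  have hI : Intertwines v (evalAt v A) (planeQuat (affinePt i a)) :=
    (evalAt_rotP_eq_iff hw).1 (by rw [← hA])
  rw [hsurj]
  constructor
  · intro H hy
    rw [hy] at hI H
    obtain ⟨w', hI', hne⟩ := exists_intertwines_not_smul hw hI
    -- Subtracting the right multiple of the base point brings the second solution into the chart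
    -- directions.
    obtain ⟨h, hh⟩ := exists_affineDir (i := i) (w := w' + (-w' i) • affinePt i a)
      (by simp [affinePt_self])
    refine H h ?_ ?_
    · rw [hh, neg_smul, ← sub_eq_add_neg]
      exact sub_ne_zero.2 (hne _)
    · rw [hh, planeQuat_add, planeQuat_smul]
      exact hI'.add (hI.smul _)
  · intro hy h hne hI'
    obtain ⟨c, hc⟩ := Intertwines.eq_smul hy hw hI hI'
    -- The `i`-th coordinates are `0` and `c`, so `c = 0`.
    have h0 := congrFun hc i
    rw [affineDir_self, Pi.smul_apply, affinePt_self, smul_eq_mul, mul_one] at h0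
    exact hne (by rw [hc, ← h0, zero_smul])

/-! ### Regular values -/

theorem isRegularValue_evalAt_iff (v y : S2) :
    IsRegularValue 2 (fun A : P => evalAt v A) y ↔ y ≠ reflY v := by
  constructor
  · intro h
    -- Surjectivity of the evaluation map is needed here: a value without preimages would be regular
    -- vacuously.
    obtain ⟨A, hA⟩ := exists_evalAt_eq v y
    rw [← hA]
    exact (surjective_mfderiv_evalAt_iff v A).1 (h A hA)
  · intro h A hA
    exact (surjective_mfderiv_evalAt_iff v A).2 (ne_of_eq_of_ne hA h)

/-- By the chain rule the two differentials differ by the invertible differential of `DbarDiffeo`,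
and `Dbar` is onto. -/
theorem isRegularValue_evalAt_Dbar_iff (v y : S2) :
    IsRegularValue 2 (fun x : Q => evalAt v (Dbar x)) y ↔
      IsRegularValue 2 (fun A : P => evalAt v A) y := by
  have key : ∀ x : Q, Function.Surjective
      (mfderiv (𝓡 2) (𝓡 2) (fun x : Q => evalAt v (Dbar x)) x) ↔
      Function.Surjective (mfderiv (𝓡 2) (𝓡 2) (fun A : P => evalAt v A) (Dbar x)) := by
    intro x
    have hcomp : mfderiv (𝓡 2) (𝓡 2) (fun x : Q => evalAt v (Dbar x)) x =
        (mfderiv (𝓡 2) (𝓡 2) (fun A : P => evalAt v A) (Dbar x)).comp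
          (mfderiv (𝓡 2) (𝓡 2) DbarDiffeo x) :=
      mfderiv_comp x ((contMDiff_evalAt v _).mdifferentiableAt (by simp))
        (DbarDiffeo.contMDiff.mdifferentiableAt (by simp))
    rw [hcomp]
    have hbij : Function.Bijective (mfderiv (𝓡 2) (𝓡 2) DbarDiffeo x) :=
      (DbarDiffeo.mfderivToContinuousLinearEquiv (by simp) x).bijective
    exact hbij.surjective.of_comp_iff _
  constructor
  · intro h A hA
    obtain ⟨x, rfl⟩ := surjective_Dbar A
    exact (key x).1 (h x hA)
  · exact fun h x hx => (key x).2 (h _ hx)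

/-! ### Counting preimages and the mod two degree -/

theorem existsUnique_evalAt_eq {v y : S2} (hy : y ≠ reflY v) : ∃! A : P, evalAt v A = y :=
  existsUnique_of_exists_of_unique (exists_evalAt_eq v y) fun _ _ => evalAt_injective_of_ne hy

theorem existsUnique_evalAt_Dbar_eq {v y : S2} (hy : y ≠ reflY v) :
    ∃! x : Q, evalAt v (Dbar x) = y :=
  (Function.Bijective.existsUnique_iff ⟨injective_Dbar, surjective_Dbar⟩).1
    (existsUnique_evalAt_eq hy)

theorem HasModTwoDegree.of_existsUnique {n : ℕ} {M N : Type*} [TopologicalSpace M]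
    [CompactSpace M] [T2Space M] [ChartedSpace (EuclideanSpace ℝ (Fin n)) M]
    [IsManifold (𝓡 n) ∞ M] [TopologicalSpace N] [CompactSpace N] [T2Space N] [ConnectedSpace N]
    [ChartedSpace (EuclideanSpace ℝ (Fin n)) N] [IsManifold (𝓡 n) ∞ N] {f : M → N}
    (hf : ContMDiff (𝓡 n) (𝓡 n) ∞ f) (hreg : ∃ y, IsRegularValue n f y)
    (h : ∀ y, IsRegularValue n f y → ∃! x, f x = y) : HasModTwoDegree n f 1 where
  contMDiff := hf
  exists_isRegularValue := hreg
  card_preimage y hy := by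
    obtain ⟨x, hx⟩ := h y hy
    have hs : f ⁻¹' {y} = {x} := Set.ext fun x' => ⟨hx.2 x', fun hx' => hx' ▸ hx.1⟩
    rw [hs]
    exact ⟨finite_singleton x, by simp⟩

/-- Provides a point other than `reflY v`, hence a regular value; a connected sphere with two points
also has no isolated points, which makes the complement of `reflY v` dense. -/
theorem nontrivial_S2 : Nontrivial S2 := by
  let e (i : Fin 3) : S2 := ⟨EuclideanSpace.single i 1, by simp⟩
  refine ⟨e 0, e 1, fun h => ?_⟩
  have := congrArg (fun x : S2 => x.1 0) h
  simp [e] at this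

end DoubleTwist

end

theorem mainTheorem8 (v : DoubleTwist.S2) :
    DoubleTwist.HasNonzeroModTwoDegree 2
      (fun A : DoubleTwist.P => DoubleTwist.evalAt v A) ∧
    DoubleTwist.HasNonzeroModTwoDegree 2
      (fun x : DoubleTwist.Q => DoubleTwist.evalAt v (DoubleTwist.Dbar x)) ∧
    (∃ U : Set DoubleTwist.S2, IsOpen U ∧ Dense U ∧ ∀ w ∈ U,
      DoubleTwist.IsRegularValue 2 (fun A : DoubleTwist.P => DoubleTwist.evalAt v A) w ∧
      ∃! A : DoubleTwist.P, DoubleTwist.evalAt v A = w) ∧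
    (∃ U : Set DoubleTwist.S2, IsOpen U ∧ Dense U ∧ ∀ w ∈ U,
      DoubleTwist.IsRegularValue 2
        (fun x : DoubleTwist.Q => DoubleTwist.evalAt v (DoubleTwist.Dbar x)) w ∧
      ∃! x : DoubleTwist.Q, DoubleTwist.evalAt v (DoubleTwist.Dbar x) = w) := by
  -- Both maps have the same regular values, so the complement of `reflY v` serves as the open dense
  -- set for each.
  have hP := DoubleTwist.isRegularValue_evalAt_iff v
  have hQ := fun y => (DoubleTwist.isRegularValue_evalAt_Dbar_iff v y).trans (hP y)
  have := DoubleTwist.nontrivial_S2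
  obtain ⟨y, hy⟩ := exists_ne (DoubleTwist.reflY v)
  have hdense : Dense ({DoubleTwist.reflY v}ᶜ : Set DoubleTwist.S2) := dense_compl_singleton _
  refine ⟨⟨1, one_ne_zero, .of_existsUnique (DoubleTwist.contMDiff_evalAt v) ⟨y, (hP y).2 hy⟩
      fun y h => DoubleTwist.existsUnique_evalAt_eq ((hP y).1 h)⟩,
    ⟨1, one_ne_zero, .of_existsUnique
      ((DoubleTwist.contMDiff_evalAt v).comp DoubleTwist.DbarDiffeo.contMDiff) ⟨y, (hQ y).2 hy⟩
      fun y h => DoubleTwist.existsUnique_evalAt_Dbar_eq ((hQ y).1 h)⟩,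
    ⟨_, isOpen_compl_singleton, hdense, fun y h =>
      ⟨(hP y).2 h, DoubleTwist.existsUnique_evalAt_eq h⟩⟩,
    ⟨_, isOpen_compl_singleton, hdense, fun y h =>
      ⟨(hQ y).2 h, DoubleTwist.existsUnique_evalAt_Dbar_eq h⟩⟩⟩
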